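/- For $x,y\in(0,1)$ put $$D(x,y)=\frac{\sqrt{\Gamma(2x+1)\Gamma(2y+1)\sin(\pi x)\sin(\pi y)}}{2\,\Gamma(x+y+1)\sin\big(\tfrac{\pi(x+y)}2\big)},$$ so that $D(x,x)=\tfrac12$. For $K\in[0,1]$ and an index set $T\subseteq(0,1)\times[0,\infty)$, a bifractional Brownian family on $T$ is a centred Gaussian family $(B^{H,K}_t)_{(H,t)\in T}$ with $$\mathbb E\big(B^{H,K}_tB^{H',K}_s\big)=D(H,H')^K\Big[\big(t^{H+H'}+s^{H+H'}\big)^K-|t-s|^{(H+H')K}\Big],\qquad (H,t),(H',s)\in T$$ (with $0^0=1$). In particular, for fixed $H\in(0,1)$ and $K\in(0,1]$, the case $T=\{H\}\times[0,\infty)$ is exactly the bifractional Brownian motion with parameters $H,K$, i.e. the centred Gaussian process with covariance $2^{-K}\big[(t^{2H}+s^{2H})^K-|t-s|^{2HK}\big]$. Let $[a,b]\subset[0,\infty)$, $[\alpha,\gamma]\subset(0,1)$ and $K\in[0,1]$. Then there is a finite constant $C>0$, depending only on $\alpha,\gamma,K$ and the interval $[a,b]$, such that for every $T$, every bifractional Brownian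 family $(B^{H,K}_t)_{(H,t)\in T}$ on any probability space, and all $H,H'\in[\alpha,\gamma]$, $$\sup_{t}\ \mathbb E\big(B^{H,K}_t-B^{H',K}_t\big)^2\le C\,|H-H'|^2,$$ where the supremum is over all $t\in[a,b]$ with $(H,t)\in T$ and $(H',t)\in T$. -/

import Mathlib

open MeasureTheory ProbabilityTheory Set
open scoped ENNReal

noncomputable section

/-- Covariance function of the bifractional Brownian motion with parameters `H`, `K`:
`R^{H,K}(t,s) = 2^{-K} ((t^{2H} + s^{2H})^K - |t-s|^{2HK})`. -/
def bfbmCov (H K t s : ℝ) : ℝ :=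
  1 / 2 ^ K * ((t ^ (2 * H) + s ^ (2 * H)) ^ K - |t - s| ^ (2 * H * K))

/-- The normalizing function of the standard multifractional Brownian motion,
`D(x,y) = √(Γ(2x+1) Γ(2y+1) sin(πx) sin(πy)) / (2 Γ(x+y+1) sin(π(x+y)/2))`, for `x, y ∈ (0,1)`. -/
def mbmD (x y : ℝ) : ℝ :=
  Real.sqrt (Real.Gamma (2 * x + 1) * Real.Gamma (2 * y + 1)
      * Real.sin (Real.pi * x) * Real.sin (Real.pi * y))
    / (2 * Real.Gamma (x + y + 1) * Real.sin (Real.pi * (x + y) / 2))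

/-- Covariance between the value at time `t` with parameter `H` and the value at time `s` with
parameter `H'` (the second parameter `K` being common):
`D(H,H')^K ((t^{H+H'} + s^{H+H'})^K - |t-s|^{(H+H')K})`. -/
def fieldCov (K H t H' s : ℝ) : ℝ :=
  mbmD H H' ^ K * ((t ^ (H + H') + s ^ (H + H')) ^ K - |t - s| ^ ((H + H') * K))

/-- `D(H,H) = 1/2`. -/
theorem mbmD_self {H : ℝ} (h0 : 0 < H) (h1 : H < 1) : mbmD H H = 1 / 2 := by
  have hs : 0 < Real.sin (Real.pi * H) :=
    Real.sin_pos_of_pos_of_lt_pi (by positivity) (by nlinarith [Real.pi_pos])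
  have hG : 0 < Real.Gamma (2 * H + 1) := Real.Gamma_pos_of_pos (by linarith)
  have e1 : Real.Gamma (2 * H + 1) * Real.Gamma (2 * H + 1) * Real.sin (Real.pi * H)
      * Real.sin (Real.pi * H) = (Real.Gamma (2 * H + 1) * Real.sin (Real.pi * H)) ^ 2 := by ring
  have e2 : H + H + 1 = 2 * H + 1 := by ring
  have e3 : Real.pi * (H + H) / 2 = Real.pi * H := by ring
  rw [mbmD, e1, e2, e3, Real.sqrt_sq (by positivity)]
  generalize Real.sin (Real.pi * H) = x at hs ⊢
  field_simp

/-- For equal parameters, the covariance is that of the bifractional Brownian motion. -/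
theorem fieldCov_self {H : ℝ} (h0 : 0 < H) (h1 : H < 1) (K t s : ℝ) :
    fieldCov K H t H s = bfbmCov H K t s := by
  rw [fieldCov, bfbmCov, mbmD_self h0 h1, ← two_mul,
    Real.div_rpow zero_le_one zero_le_two, Real.one_rpow]

/-- `B = (B t)_{t ≥ 0}` is a bifractional Brownian motion with parameters `H`, `K`: a centred
Gaussian process with covariance function `R^{H,K}`. -/
structure IsBfBm {Ω : Type*} [MeasurableSpace Ω] (μ : Measure Ω) (H K : ℝ)
    (B : ℝ → Ω → ℝ) : Prop where
  gaussian : IsGaussianProcess (fun t : Ici (0 : ℝ) => B t) μ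
  centred : ∀ t, 0 ≤ t → ∫ ω, B t ω ∂μ = 0
  cov : ∀ t s, 0 ≤ t → 0 ≤ s → ∫ ω, B t ω * B s ω ∂μ = bfbmCov H K t s

/-- `(B H t)`, for `(H, t)` in the index set `T ⊆ (0,1) × [0,∞)`, is a bifractional Brownian
family with second parameter `K`: a centred Gaussian family in which `B H t` and `B H' s` have
covariance `D(H,H')^K ((t^{H+H'} + s^{H+H'})^K - |t-s|^{(H+H')K})`.
When `T = {H} × [0,∞)`, this says that `B H` is a bifractional Brownian motion; when `T` is the
graph of a function `t ↦ H(t)`, it is the multifractional process `B^{H(.),K}`. -/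
structure IsBfBmFamily {Ω : Type*} [MeasurableSpace Ω] (μ : Measure Ω) (K : ℝ)
    (T : Set (ℝ × ℝ)) (B : ℝ → ℝ → Ω → ℝ) : Prop where
  index : T ⊆ Ioo (0 : ℝ) 1 ×ˢ Ici (0 : ℝ)
  gaussian : IsGaussianProcess (fun p : T => B p.1.1 p.1.2) μ
  centred : ∀ H t, (H, t) ∈ T → ∫ ω, B H t ω ∂μ = 0
  cov : ∀ H t H' s, (H, t) ∈ T → (H', s) ∈ T →
    ∫ ω, B H t ω * B H' s ω ∂μ = fieldCov K H t H' s

/-- For each `H` whose whole half-line is indexed, `B H` is a bifractional Brownian motion. -/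
theorem IsBfBmFamily.isBfBm {Ω : Type*} [MeasurableSpace Ω] {μ : Measure Ω} {K : ℝ}
    {T : Set (ℝ × ℝ)} {B : ℝ → ℝ → Ω → ℝ} (h : IsBfBmFamily μ K T B) {H : ℝ}
    (hT : ∀ t : ℝ, 0 ≤ t → (H, t) ∈ T) : IsBfBm μ H K (B H) where
  gaussian := h.gaussian.comp_right (fun t : Ici (0 : ℝ) => (⟨(H, t.1), hT t.1 t.2⟩ : T))
  centred t ht := h.centred H t (hT t ht)
  cov t s ht hs := by
    have hH := (h.index (hT t ht)).1
    rw [h.cov H t H s (hT t ht) (hT s hs), fieldCov_self hH.1 hH.2]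

/-- A bifractional Brownian motion is the same as a bifractional Brownian family indexed by
`{H} × [0,∞)`. -/
theorem isBfBmFamily_singleton_iff {Ω : Type*} [MeasurableSpace Ω] {μ : Measure Ω} {H K : ℝ}
    (h0 : 0 < H) (h1 : H < 1) {B : ℝ → ℝ → Ω → ℝ} :
    IsBfBmFamily μ K ({H} ×ˢ Ici (0 : ℝ)) B ↔ IsBfBm μ H K (B H) := by
  refine ⟨fun h => h.isBfBm fun t ht => ⟨rfl, ht⟩, fun h => ⟨?_, ?_, ?_, ?_⟩⟩
  · rintro ⟨x, t⟩ ⟨hx, ht⟩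
    obtain rfl : x = H := hx
    exact ⟨⟨h0, h1⟩, ht⟩
  · have key := h.gaussian.comp_right
      (fun p : ↥({H} ×ˢ Ici (0 : ℝ)) => (⟨p.1.2, p.2.2⟩ : Ici (0 : ℝ)))
    have e : (fun p : ↥({H} ×ˢ Ici (0 : ℝ)) => B p.1.1 p.1.2)
        = (fun t : Ici (0 : ℝ) => B H t) ∘
          (fun p : ↥({H} ×ˢ Ici (0 : ℝ)) => (⟨p.1.2, p.2.2⟩ : Ici (0 : ℝ))) := by
      funext p
      have hp : p.1.1 = H := p.2.1
      simp [hp]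
    rw [e]
    exact key
  · rintro x t ⟨hx, ht⟩
    obtain rfl : x = H := hx
    exact h.centred t ht
  · rintro x t y s ⟨hx, ht⟩ ⟨hy, hs⟩
    obtain rfl : x = H := hx
    obtain rfl : y = x := hy
    rw [h.cov t s ht hs, fieldCov_self h0 h1]

end

/-!
At equal times `t > 0` and for `K > 0` the covariance of the family is
`(2 D(H,H'))^K t^{(H+H')K}`, and it vanishes for `t = 0` or `K = 0`, so that
`𝔼(B^{H,K}_t - B^{H',K}_t)² = (t^{HK} - t^{H'K})² + 2 t^{(H+H')K} (1 - (2 D(H,H'))^K)`.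

The first term is quadratic in `H - H'` because `x ↦ t^{xK}` is Lipschitz on `[α, 1]`, uniformly in
`t ∈ (0, b]` (`abs_rpow_mul_sub_rpow_mul_le`): its derivative is `K t^{xK} log t`, which stays
bounded as `t → 0`.

For the second term, `1 - z^K ≤ 1 - z` for `z ∈ (0, 1]` reduces the problem to a bound on
`1 - 2 D(H,H')`. Log-convexity of `Γ` gives `Γ(x+y+1)² ≤ Γ(2x+1) Γ(2y+1)`, so the Gamma factors can
only increase `D`, while
`sin(πx) sin(πy) = sin²(π(x+y)/2) - sin²(π(x-y)/2)` shows that the sine factors lower `2 D` from `1`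
by an amount quadratic in `x - y` (`one_sub_two_mul_mbmD_le`).
-/

open Real in
/-- Midpoint log-convexity of `Γ`, in multiplicative form. -/
theorem Gamma_add_add_one_sq_le {x y : ℝ} (hx : 0 < x) (hy : 0 < y) :
    Gamma (x + y + 1) ^ 2 ≤ Gamma (2 * x + 1) * Gamma (2 * y + 1) := by
  have hGx : 0 < Gamma (2 * x + 1) := Gamma_pos_of_pos (by linarith)
  have hGy : 0 < Gamma (2 * y + 1) := Gamma_pos_of_pos (by linarith)
  have hG : 0 < Gamma (x + y + 1) := Gamma_pos_of_pos (by linarith)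
  have h := Gamma_mul_add_mul_le_rpow_Gamma_mul_rpow_Gamma (s := 2 * x + 1) (t := 2 * y + 1)
    (a := 1 / 2) (b := 1 / 2) (by linarith) (by linarith) (by norm_num) (by norm_num) (by norm_num)
  rw [show 1 / 2 * (2 * x + 1) + 1 / 2 * (2 * y + 1) = x + y + 1 by ring,
    ← sqrt_eq_rpow, ← sqrt_eq_rpow, ← sqrt_mul hGx.le] at h
  calc Gamma (x + y + 1) ^ 2 ≤ √(Gamma (2 * x + 1) * Gamma (2 * y + 1)) ^ 2 := by gcongr
    _ = _ := sq_sqrt (by positivity)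

open Real in
theorem mbmD_pos {x y : ℝ} (hx : x ∈ Ioo (0 : ℝ) 1) (hy : y ∈ Ioo (0 : ℝ) 1) :
    0 < mbmD x y := by
  obtain ⟨hx0, hx1⟩ := hx
  obtain ⟨hy0, hy1⟩ := hy
  have hπ := pi_pos
  have hGx : 0 < Gamma (2 * x + 1) := Gamma_pos_of_pos (by linarith)
  have hGy : 0 < Gamma (2 * y + 1) := Gamma_pos_of_pos (by linarith)
  have hG : 0 < Gamma (x + y + 1) := Gamma_pos_of_pos (by linarith)
  have hsx : 0 < sin (π * x) := sin_pos_of_pos_of_lt_pi (by positivity) (by nlinarith)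
  have hsy : 0 < sin (π * y) := sin_pos_of_pos_of_lt_pi (by positivity) (by nlinarith)
  have hs : 0 < sin (π * (x + y) / 2) :=
    sin_pos_of_pos_of_lt_pi (by positivity) (by nlinarith)
  unfold mbmD
  positivity

open Real in
theorem one_sub_two_mul_mbmD_le {x y : ℝ} (hx : x ∈ Ioo (0 : ℝ) 1) (hy : y ∈ Ioo (0 : ℝ) 1) :
    1 - 2 * mbmD x y ≤ (π / 2) ^ 2 / sin (π * (x + y) / 2) ^ 2 * |x - y| ^ 2 := by
  have hDpos := mbmD_pos hx hy
  obtain ⟨hx0, hx1⟩ := hx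
  obtain ⟨hy0, hy1⟩ := hy
  have hπ := pi_pos
  have hG : 0 < Gamma (x + y + 1) := Gamma_pos_of_pos (by linarith)
  have hsx : 0 < sin (π * x) := sin_pos_of_pos_of_lt_pi (by positivity) (by nlinarith)
  have hsy : 0 < sin (π * y) := sin_pos_of_pos_of_lt_pi (by positivity) (by nlinarith)
  have hs : 0 < sin (π * (x + y) / 2) :=
    sin_pos_of_pos_of_lt_pi (by positivity) (by nlinarith)
  set S := sin (π * (x + y) / 2) with hS
  set d := sin (π * (x - y) / 2) with hd
  have hprod : sin (π * x) * sin (π * y) = S ^ 2 - d ^ 2 := by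
    rw [show π * x = π * (x + y) / 2 + π * (x - y) / 2 by ring,
      show π * y = π * (x + y) / 2 - π * (x - y) / 2 by ring, sin_add, sin_sub, ← hS, ← hd]
    linear_combination S ^ 2 * sin_sq_add_cos_sq (π * (x - y) / 2) -
      d ^ 2 * sin_sq_add_cos_sq (π * (x + y) / 2)
  have hsq : (2 * mbmD x y) ^ 2 = Gamma (2 * x + 1) * Gamma (2 * y + 1) /
      Gamma (x + y + 1) ^ 2 * ((S ^ 2 - d ^ 2) / S ^ 2) := by
    have hGx : 0 < Gamma (2 * x + 1) := Gamma_pos_of_pos (by linarith)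
    have hGy : 0 < Gamma (2 * y + 1) := Gamma_pos_of_pos (by linarith)
    unfold mbmD
    rw [← hS, ← hprod, mul_pow, div_pow, sq_sqrt (by positivity)]
    field_simp
  have hpos : 0 < S ^ 2 - d ^ 2 := by rw [← hprod]; positivity
  have hge : 1 - d ^ 2 / S ^ 2 ≤ (2 * mbmD x y) ^ 2 := by
    rw [hsq, show 1 - d ^ 2 / S ^ 2 = (S ^ 2 - d ^ 2) / S ^ 2 by field_simp]
    exact le_mul_of_one_le_left (by positivity)
      ((one_le_div (by positivity)).2 (Gamma_add_add_one_sq_le hx0 hy0))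
  have hdle : d ^ 2 ≤ (π / 2) ^ 2 * |x - y| ^ 2 := by
    rw [← mul_pow, ← sq_abs d]
    refine pow_le_pow_left₀ (abs_nonneg d) (abs_sin_le_abs.trans_eq ?_) 2
    rw [abs_div, abs_mul, abs_of_pos hπ, abs_two]
    ring
  have hq : d ^ 2 / S ^ 2 ≤ (π / 2) ^ 2 / S ^ 2 * |x - y| ^ 2 := by
    rw [div_mul_eq_mul_div]
    gcongr
  refine le_trans ?_ hq
  have hq0 : 0 ≤ d ^ 2 / S ^ 2 := by positivity
  -- if `z ≥ 0` and `1 - q ≤ z²`, then `z ≥ 1`, or `z² ≤ z` and hence `1 - z ≤ q`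
  rcases le_total 1 (2 * mbmD x y) with h1 | h1
  · linarith
  · nlinarith

open Real in
/-- For `t ≤ 1` the factor `t^u` compensates the logarithm near `0`; for `t ≥ 1` both factors are
at most `t`, as `u ≤ 1`. -/
theorem rpow_mul_abs_log_le {c u t b : ℝ} (hc : 0 < c) (hcu : c ≤ u) (hu : u ≤ 1)
    (ht : 0 < t) (htb : t ≤ b) : t ^ u * |log t| ≤ 1 / c + b ^ 2 := by
  rcases le_total t 1 with h1 | h1
  · have h := abs_log_mul_self_rpow_lt t c ht h1 hc
    rw [abs_mul, abs_of_pos (rpow_pos_of_pos ht c)] at h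
    have h2 : t ^ u ≤ t ^ c := rpow_le_rpow_of_exponent_ge ht h1 hcu
    nlinarith [abs_nonneg (log t), sq_nonneg b]
  · have h2 : t ^ u ≤ t := by simpa using rpow_le_rpow_of_exponent_le h1 hu
    have h3 : |log t| ≤ t := by
      rw [abs_of_nonneg (log_nonneg h1)]
      linarith [log_le_sub_one_of_pos ht]
    have h4 : t ^ u * |log t| ≤ t * t := by gcongr
    have : 0 < 1 / c := by positivity
    nlinarith

open Real in
theorem abs_exp_sub_exp_le (u v : ℝ) : |exp u - exp v| ≤ max (exp u) (exp v) * |u - v| := by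
  wlog h : v ≤ u generalizing u v
  · rw [abs_sub_comm, max_comm, abs_sub_comm u]
    exact this v u (le_of_not_ge h)
  have h1 := add_one_le_exp (v - u)
  have h2 : exp (v - u) * exp u = exp v := by rw [← exp_add]; ring_nf
  have h3 : exp v ≤ exp u := exp_le_exp.2 h
  rw [max_eq_left h3, abs_of_nonneg (sub_nonneg.2 h3), abs_of_nonneg (sub_nonneg.2 h)]
  nlinarith [exp_pos u]

open Real in
/-- The constant does not depend on `K`: the factor `K` of the derivative cancels the blow-up
`1 / (α K)` of `sup t^{αK} |log t|`. -/
theorem abs_rpow_mul_sub_rpow_mul_le {α K t b x y : ℝ} (hα : 0 < α) (hK : 0 < K) (hK1 : K ≤ 1)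
    (ht : 0 < t) (htb : t ≤ b) (hx : x ∈ Icc α 1) (hy : y ∈ Icc α 1) :
    |t ^ (x * K) - t ^ (y * K)| ≤ (1 / α + b ^ 2) * |x - y| := by
  have key : ∀ z ∈ Icc α 1, t ^ (z * K) * |log t| ≤ 1 / (α * K) + b ^ 2 := fun z hz ↦
    rpow_mul_abs_log_le (by positivity) (by gcongr; exact hz.1)
      (mul_le_one₀ hz.2 hK.le hK1) ht htb
  have hmax : max (t ^ (x * K)) (t ^ (y * K)) * |log t| ≤ 1 / (α * K) + b ^ 2 := by
    rw [max_mul_of_nonneg _ _ (abs_nonneg _)]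
    exact max_le (key x hx) (key y hy)
  have h := abs_exp_sub_exp_le (log t * (x * K)) (log t * (y * K))
  rw [← rpow_def_of_pos ht, ← rpow_def_of_pos ht,
    show log t * (x * K) - log t * (y * K) = log t * (K * (x - y)) by ring, abs_mul, abs_mul,
    abs_of_pos hK] at h
  calc |t ^ (x * K) - t ^ (y * K)|
      ≤ max (t ^ (x * K)) (t ^ (y * K)) * |log t| * (K * |x - y|) := by linarith
    _ ≤ (1 / (α * K) + b ^ 2) * (K * |x - y|) := by gcongr
    _ = (1 / α + K * b ^ 2) * |x - y| := by field_simp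
    _ ≤ (1 / α + b ^ 2) * |x - y| := by
        gcongr
        nlinarith [sq_nonneg b]

theorem fieldCov_eq_of_time_eq {K H H' t : ℝ} (hK : 0 < K) (hH : H ∈ Ioo (0 : ℝ) 1)
    (hH' : H' ∈ Ioo (0 : ℝ) 1) (ht : 0 ≤ t) :
    fieldCov K H t H' t = (2 * mbmD H H') ^ K * t ^ ((H + H') * K) := by
  have hpos : 0 < (H + H') * K := mul_pos (add_pos hH.1 hH'.1) hK
  have hD := mbmD_pos hH hH'
  rw [fieldCov, sub_self, abs_zero, Real.zero_rpow hpos.ne', sub_zero, ← two_mul,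
    Real.mul_rpow zero_le_two (by positivity), Real.mul_rpow zero_le_two hD.le,
    Real.rpow_mul ht]
  ring

/-- For a bifractional Brownian family the left-hand side is `𝔼(B^{H,K}_t - B^{H',K}_t)²`. -/
theorem fieldCov_increment_le {b α γ K H H' t : ℝ} (hα : 0 < α) (hγ : γ < 1)
    (hK0 : 0 ≤ K) (hK1 : K ≤ 1) (ht : 0 ≤ t) (htb : t ≤ b) (hH : H ∈ Icc α γ)
    (hH' : H' ∈ Icc α γ) :
    fieldCov K H t H t + fieldCov K H' t H' t - 2 * fieldCov K H t H' t ≤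
      ((1 / α + b ^ 2) ^ 2 + 2 * (1 + b ^ 2) * ((Real.pi / 2) ^ 2 /
        (min (Real.sin (Real.pi * α)) (Real.sin (Real.pi * γ))) ^ 2)) * |H - H'| ^ 2 := by
  have hI : ∀ x ∈ Icc α γ, x ∈ Ioo (0 : ℝ) 1 := fun x hx ↦ ⟨hα.trans_le hx.1, hx.2.trans_lt hγ⟩
  have hHI := hI H hH
  have hHI' := hI H' hH'
  rcases hK0.eq_or_lt with rfl | hK
  · have h0 : ∀ x y, fieldCov 0 x t y t = 0 := fun x y ↦ by simp [fieldCov]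
    rw [h0, h0, h0]
    simp only [add_zero, mul_zero, sub_zero]
    positivity
  rcases ht.eq_or_lt with rfl | ht'
  · have h0 : ∀ x ∈ Ioo (0 : ℝ) 1, ∀ y ∈ Ioo (0 : ℝ) 1, fieldCov K x 0 y 0 = 0 := by
      intro x hx y hy
      have hpos : 0 < (x + y) * K := mul_pos (add_pos hx.1 hy.1) hK
      rw [fieldCov_eq_of_time_eq hK hx hy le_rfl, Real.zero_rpow hpos.ne', mul_zero]
    rw [h0 H hHI H hHI, h0 H' hHI' H' hHI', h0 H hHI H' hHI']
    simp only [add_zero, mul_zero, sub_zero]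
    positivity
  have hsin : min (Real.sin (Real.pi * α)) (Real.sin (Real.pi * γ)) ≤
      Real.sin (Real.pi * (H + H') / 2) := by
    have hπ := Real.pi_pos
    have hαγ : α ≤ γ := hH.1.trans hH.2
    refine strictConcaveOn_sin_Icc.concaveOn.min_le_of_mem_Icc
      ⟨by positivity, by nlinarith⟩ ⟨by nlinarith, by nlinarith⟩ ⟨?_, ?_⟩
    · nlinarith [hH.1, hH'.1]
    · nlinarith [hH.2, hH'.2]
  have hσ : 0 < min (Real.sin (Real.pi * α)) (Real.sin (Real.pi * γ)) := by
    have hπ := Real.pi_pos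
    have hαγ : α ≤ γ := hH.1.trans hH.2
    exact lt_min (Real.sin_pos_of_pos_of_lt_pi (by positivity) (by nlinarith))
      (Real.sin_pos_of_pos_of_lt_pi (by nlinarith) (by nlinarith))
  set σ := min (Real.sin (Real.pi * α)) (Real.sin (Real.pi * γ))
  have hD : 1 - (2 * mbmD H H') ^ K ≤ (Real.pi / 2) ^ 2 / σ ^ 2 * |H - H'| ^ 2 := by
    have hDpos := mbmD_pos hHI hHI'
    rcases le_total 1 (2 * mbmD H H') with h1 | h1
    · have : 1 ≤ (2 * mbmD H H') ^ K := Real.one_le_rpow h1 hK.le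
      have : 0 ≤ (Real.pi / 2) ^ 2 / σ ^ 2 * |H - H'| ^ 2 := by positivity
      linarith
    · have h2 : 2 * mbmD H H' ≤ (2 * mbmD H H') ^ K := by
        simpa using Real.rpow_le_rpow_of_exponent_ge (by positivity) h1 hK1
      calc 1 - (2 * mbmD H H') ^ K ≤ 1 - 2 * mbmD H H' := by linarith
        _ ≤ _ := one_sub_two_mul_mbmD_le hHI hHI'
        _ ≤ _ := by gcongr
  have hL := abs_rpow_mul_sub_rpow_mul_le hα hK hK1 ht' htb
    ⟨hH.1, hHI.2.le⟩ ⟨hH'.1, hHI'.2.le⟩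
  have hL2 : (t ^ (H * K) - t ^ (H' * K)) ^ 2 ≤ (1 / α + b ^ 2) ^ 2 * |H - H'| ^ 2 := by
    rw [← mul_pow, ← sq_abs (t ^ (H * K) - _)]
    gcongr
  have ht2 : t ^ (H * K) * t ^ (H' * K) ≤ 1 + b ^ 2 := by
    have hle : ∀ x ∈ Ioo (0 : ℝ) 1, t ^ (x * K) ≤ max 1 t := by
      intro x hx
      rcases le_total t 1 with h1 | h1
      · exact le_max_of_le_left (Real.rpow_le_one ht h1 (mul_nonneg hx.1.le hK.le))
      · refine le_max_of_le_right ?_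
        simpa using Real.rpow_le_rpow_of_exponent_le h1 (mul_le_one₀ hx.2.le hK.le hK1)
    calc t ^ (H * K) * t ^ (H' * K) ≤ max 1 t * max 1 t := by
          gcongr
          exacts [hle H hHI, hle H' hHI']
      _ ≤ 1 + b ^ 2 := by
          rcases max_cases 1 t with ⟨h, _⟩ | ⟨h, _⟩ <;> rw [h] <;> nlinarith
  have hself : ∀ x ∈ Ioo (0 : ℝ) 1, fieldCov K x t x t = t ^ (x * K) * t ^ (x * K) := by
    intro x hx
    rw [fieldCov_eq_of_time_eq hK hx hx ht, mbmD_self hx.1 hx.2, add_mul, Real.rpow_add ht']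
    norm_num
  rw [hself H hHI, hself H' hHI', fieldCov_eq_of_time_eq hK hHI hHI' ht, add_mul,
    Real.rpow_add ht']
  set p := t ^ (H * K)
  set q := t ^ (H' * K)
  have hpq : 0 ≤ p * q := by positivity
  have hprod : p * q * (1 - (2 * mbmD H H') ^ K) ≤
      (1 + b ^ 2) * ((Real.pi / 2) ^ 2 / σ ^ 2 * |H - H'| ^ 2) :=
    (mul_le_mul_of_nonneg_left hD hpq).trans (by gcongr)
  linarith

theorem IsBfBmFamily.lintegral_increment_sq {Ω : Type*} [MeasurableSpace Ω] {μ : Measure Ω}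
    {K : ℝ} {T : Set (ℝ × ℝ)} {B : ℝ → ℝ → Ω → ℝ} (h : IsBfBmFamily μ K T B) {H H' t : ℝ}
    (hH : (H, t) ∈ T) (hH' : (H', t) ∈ T) :
    ∫⁻ ω, ENNReal.ofReal ((B H t ω - B H' t ω) ^ 2) ∂μ =
      ENNReal.ofReal (fieldCov K H t H t + fieldCov K H' t H' t - 2 * fieldCov K H t H' t) := by
  have hL : MemLp (B H t) 2 μ := (h.gaussian.hasGaussianLaw_eval ⟨(H, t), hH⟩).memLp_two
  have hL' : MemLp (B H' t) 2 μ := (h.gaussian.hasGaussianLaw_eval ⟨(H', t), hH'⟩).memLp_two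
  have hsq : Integrable (fun ω ↦ (B H t ω - B H' t ω) ^ 2) μ := (hL.sub hL').integrable_sq
  rw [← ofReal_integral_eq_lintegral_ofReal hsq (ae_of_all _ fun ω ↦ sq_nonneg _),
    ← h.cov H t H t hH hH, ← h.cov H' t H' t hH' hH', ← h.cov H t H' t hH hH']
  have i1 : Integrable (fun ω ↦ B H t ω * B H t ω) μ := hL.integrable_mul hL
  have i2 : Integrable (fun ω ↦ B H' t ω * B H' t ω) μ := hL'.integrable_mul hL'
  have i3 : Integrable (fun ω ↦ B H t ω * B H' t ω) μ := hL.integrable_mul hL'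
  have i12 : Integrable (fun ω ↦ B H t ω * B H t ω + B H' t ω * B H' t ω) μ := i1.add i2
  rw [← integral_const_mul, ← integral_add i1 i2, ← integral_sub i12 (i3.const_mul 2)]
  congr 2 with ω
  ring

theorem proposition2 (a b α γ K : ℝ) (ha : 0 ≤ a) (hab : a ≤ b)
    (hα : 0 < α) (hαγ : α ≤ γ) (hγ : γ < 1) (hK0 : 0 ≤ K) (hK1 : K ≤ 1) :
    ∃ C : ℝ, 0 < C ∧
      ∀ (Ω : Type*) [MeasurableSpace Ω] (μ : Measure Ω) [IsProbabilityMeasure μ]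
        (T : Set (ℝ × ℝ)) (B : ℝ → ℝ → Ω → ℝ), IsBfBmFamily μ K T B →
      ∀ H ∈ Icc α γ, ∀ H' ∈ Icc α γ,
        (⨆ t ∈ {t : ℝ | t ∈ Icc a b ∧ (H, t) ∈ T ∧ (H', t) ∈ T},
            ∫⁻ ω, ENNReal.ofReal ((B H t ω - B H' t ω) ^ 2) ∂μ)
          ≤ ENNReal.ofReal (C * |H - H'| ^ 2) := by
  refine ⟨(1 / α + b ^ 2) ^ 2 + 2 * (1 + b ^ 2) * ((Real.pi / 2) ^ 2 /
    (min (Real.sin (Real.pi * α)) (Real.sin (Real.pi * γ))) ^ 2), by positivity, ?_⟩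
  intro Ω _ μ _ T B hB H hH H' hH'
  refine iSup₂_le fun t ht ↦ ?_
  obtain ⟨htab, hT, hT'⟩ := ht
  rw [hB.lintegral_increment_sq hT hT']
  exact ENNReal.ofReal_le_ofReal
    (fieldCov_increment_le hα hγ hK0 hK1 (ha.trans htab.1) htab.2 hH hH')
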